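/- **Setting.** For integers $d,s\ge 0$, an $s$-sparse compression map is a linear map $\varphi:\mathbb{R}^d\times\mathbb{R}^d\to\mathbb{R}^d$, $\varphi(x,y)=A_0x+A_1y$, where each column of $A_0$ and of $A_1$ has exactly $s$ non-zero entries, all equal to $\pm\frac1{\sqrt s}$. A probability distribution $\mathcal F$ on such maps is an $(\varepsilon,\delta)$-law if for all fixed $x,y\in\mathbb{R}^d$, with probability at least $1-\delta$ over $\varphi\sim\mathcal F$, $$(1-\varepsilon)(\|x\|^2+\|y\|^2)\le\|\varphi(x,y)\|^2\le(1+\varepsilon)(\|x\|^2+\|y\|^2).$$ Given $x\in\mathbb{R}^m$ with $m=2^kd$, procedure SingleSketch picks $k$ independent maps $\varphi_1,\dots,\varphi_k\sim\mathcal F$, cuts $x$ into $2^k$ consecutive blocks $v^{(0)}_1,\dots,v^{(0)}_{2^k}\in\mathbb{R}^d$, computes $$v^{(i)}_j=\varphi_i\bigl(v^{(i-1)}_{2j-1},v^{(i-1)}_{2j}\bigr)\qquad(1\le i\le k,\ 1\le j\le 2^{k-i}),$$ and returns $v=v^{(k)}_1\in\mathbb{R}^d$. Each $\varphi_i$ is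 evaluated entry by entry from its list of non-zero entries. Running time is the number of unit-cost steps (arithmetic operations, memory accesses, loop iterations, and a constant number of steps for each non-zero entry of the maps that are picked). **Theorem.** There is an absolute constant $C>0$ such that for every $\gamma>0$ there are $C_0,C_s>0$ such that for every $C_1\ge C_0$ there is $K>0$ with the following property. Let $n\ge2$ be an integer, $0<\varepsilon\le1$, and let $d$ be an integer with $$C_0\frac{\log n}{\varepsilon^2}\le d\le C_1\frac{\log n}{\varepsilon^2}.$$ 1. For some $1\le s\le d$ with $s\le C_s\,\varepsilon d$, the distribution that, independently in each column of $A_0$ and $A_1$, chooses $s$ distinct positions uniformly at random and fills them with independent uniform values $\pm\frac1{\sqrt s}$ is an $(\varepsilon,n^{-(\gamma+1)})$-law. 2. Let $s\le C_s\,\varepsilon d$, let $\mathcal F$ be any $(\varepsilon,n^{-(\gamma+1)})$-law on $s$-sparse compression maps, let $k\ge0$ be an integer with $k\varepsilon\le1$ (that is, $\varepsilon\le\frac1k$ if $k\ge1$), let $m=2^kd$, and suppose that $m/d=2^k\le n$ (which holds in particular if $m\le n$). Then: * (stretch) for every fixed $x\in\mathbb{R}^m$, with probability at least $1-n^{-\gamma}$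 over the choice of $\varphi_1,\dots,\varphi_k$, the output $v$ of SingleSketch satisfies $$(1-Ck\varepsilon)\|x\|\le\|v\|\le(1+Ck\varepsilon)\|x\|;$$ * (time) for every $x$ and every outcome of the random choice, SingleSketch takes at most $K\,\frac{m\log n}{\varepsilon}$ steps; * (linearity) for every outcome of the random choice, the map $\mathbb{R}^m\to\mathbb{R}^d$, $x\mapsto v$, is linear. -/

import Mathlib

open MeasureTheory ProbabilityTheory

noncomputable section

namespace Sketch

/-! ### Step counting

A computation is a value together with the number of elementary steps spent on it, in the unit-cost
model over the reals: every arithmetic operation, every access to one memory cell and every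
loop iteration is one step. -/

/-- A value together with the number of steps spent to compute it. -/
structure Timed (α : Type) where
  val : α
  steps : ℕ

instance : Monad Timed where
  pure a := ⟨a, 0⟩
  bind x f := ⟨(f x.val).val, x.steps + (f x.val).steps⟩

namespace Timed

/-- One elementary step with result `a`. -/
def step {α : Type} (a : α) : Timed α := ⟨a, 1⟩

/-- Read one cell of an array. -/
def read {ι α : Type} (x : ι → α) (i : ι) : Timed α := step (x i)

/-- Overwrite one cell of an array. -/
def write {ι : Type} [DecidableEq ι] (x : ι → ℝ) (i : ι) (a : ℝ) : Timed (ι → ℝ) :=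
  step (Function.update x i a)

/-- One addition. -/
def add (a b : ℝ) : Timed ℝ := step (a + b)

/-- One multiplication. -/
def mul (a b : ℝ) : Timed ℝ := step (a * b)

/-- The loop `for i < n, out[i] := f i`: all bodies are run and paid for, and each
iteration costs one more step. -/
def tabulate {α : Type} (n : ℕ) (f : Fin n → Timed α) : Timed (Fin n → α) :=
  ⟨fun i => (f i).val, ∑ i, ((f i).steps + 1)⟩

/-- The loop `for i < n, z := f z i`: all bodies are run one after the other and paid for,
and each iteration costs one more step. -/
def loop {α : Type} (n : ℕ) (z : α) (f : α → Fin n → Timed α) : Timed α :=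
  (List.finRange n).foldlM (fun z i => do
    let z' ← f z i
    step z') z

end Timed

/-! ### Sparse random maps `ℝ^d × ℝ^d → ℝ^d` -/

/-- A column of a `d`-row matrix with exactly `s` non-zero entries: their (distinct) rows and their
signs, the common absolute value being `1 / √s`. -/
@[ext] structure Column (d s : ℕ) where
  row : Fin s ↪ Fin d
  sign : Fin s → Bool

/-- The value `± 1 / √s` of the `t`-th stored entry of a column. -/
def Column.coef {d s : ℕ} (a : Column d s) (t : Fin s) : ℝ :=
  (if a.sign t then 1 else -1) / √(s : ℝ)

/-- The map `(x, y) ↦ A₀ x + A₁ y`, stored as the columns of `A₀` and of `A₁`. -/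
@[ext] structure Compression (d s : ℕ) where
  left : Fin d → Column d s
  right : Fin d → Column d s

/-- All events are measurable on this finite type. -/
instance (d s : ℕ) : MeasurableSpace (Compression d s) := ⊤

/-- The `d × d` matrix with given sparse columns: entry `(r, c)` is the coefficient stored for row
`r` in column `c`, and `0` if there is none. -/
def toMatrix {d s : ℕ} (A : Fin d → Column d s) : Matrix (Fin d) (Fin d) ℝ :=
  Matrix.of fun r c => ∑ t, if (A c).row t = r then (A c).coef t else 0

/-- `φ(x, y) = A₀ x + A₁ y`. -/
def Compression.eval {d s : ℕ} (φ : Compression d s) (x y : Fin d → ℝ) : Fin d → ℝ :=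
  (toMatrix φ.left).mulVec x + (toMatrix φ.right).mulVec y

/-- The Euclidean norm. -/
def norm2 {n : ℕ} (x : Fin n → ℝ) : ℝ := ‖(WithLp.toLp 2 x : EuclideanSpace ℝ (Fin n))‖

/-- `F` is a probability distribution of maps `φ(x, y) = A₀ x + A₁ y`, with `A₀`, `A₁` having
exactly `s` entries `± 1 / √s` in each column and zeros elsewhere, such that for every fixed
`(x, y)`, with probability at least `1 - δ`, `‖φ(x, y)‖² = (1 ± ε) (‖x‖² + ‖y‖²)`. -/
structure IsCompressionLaw {d s : ℕ} (F : Measure (Compression d s)) (ε δ : ℝ) : Prop where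
  isProbabilityMeasure : IsProbabilityMeasure F
  preserves : ∀ x y : Fin d → ℝ,
    1 - δ ≤ F.real {φ : Compression d s |
      (1 - ε) * (norm2 x ^ 2 + norm2 y ^ 2) ≤ norm2 (φ.eval x y) ^ 2 ∧
      norm2 (φ.eval x y) ^ 2 ≤ (1 + ε) * (norm2 x ^ 2 + norm2 y ^ 2)}

/-- The sparse sign distribution: in each column of `A₀` and of `A₁`, independently, `s` distinct
positions are chosen uniformly at random and filled with independent uniform signs (times
`1 / √s`); that is, the uniform distribution on the finite type `Compression d s`. -/
def sparseSignLaw (d s : ℕ) : Measure (Compression d s) := uniformOn Set.univ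

/-! ### The procedure -/

/-- `z := z + A x`, entry by entry over the stored entries of `A`. -/
def addProduct {d s : ℕ} (A : Fin d → Column d s) (x z : Fin d → ℝ) : Timed (Fin d → ℝ) :=
  Timed.loop d z fun z c => do
    let xc ← Timed.read x c
    Timed.loop s z fun z t => do
      let r ← Timed.read (A c).row t
      let a ← Timed.read (A c).coef t
      let p ← Timed.mul a xc
      let zr ← Timed.read z r
      let q ← Timed.add zr p
      Timed.write z r q

/-- Evaluation of `φ(x, y) = A₀ x + A₁ y`. -/
def applyMap {d s : ℕ} (φ : Compression d s) (x y : Fin d → ℝ) : Timed (Fin d → ℝ) := do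
  let z ← Timed.tabulate d fun _ => Timed.step (0 : ℝ)
  let z ← addProduct φ.left x z
  addProduct φ.right y z

/-- The main loop: at each level, the pairs of consecutive vectors are compressed with the
map of that level, until one vector is left. -/
def compress {d s : ℕ} : (k : ℕ) → (Fin k → Compression d s) → (Fin (2 ^ k) → Fin d → ℝ) →
    Timed (Fin d → ℝ)
  | 0, _, v => Timed.read v ⟨0, by norm_num⟩
  | k + 1, φ, v => do
    let w ← Timed.tabulate (2 ^ k) fun j =>
      applyMap (φ 0) (v ⟨2 * j, by have := j.isLt; rw [pow_succ]; omega⟩)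
        (v ⟨2 * j + 1, by have := j.isLt; rw [pow_succ]; omega⟩)
    compress k (fun i => φ i.succ) w

/-- Picking the `k` maps, `φ` being the outcome of the draw. For each of the `2 d s` stored entries
of each map we pay for drawing its position, for drawing its sign and for storing its coefficient;
two more steps compute `1 / √s`. -/
def pick {d s k : ℕ} (φ : Fin k → Compression d s) : Timed (Fin k → Compression d s) :=
  ⟨φ, 2 + 3 * (k * (2 * d * s))⟩

/-- Cut a vector of dimension `2 ^ k * d` into `2 ^ k` consecutive blocks of dimension `d`
(`finProdFinEquiv (i, j)` is the index `j + d * i`). -/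
def partition {d k : ℕ} (x : Fin (2 ^ k * d) → ℝ) : Timed (Fin (2 ^ k) → Fin d → ℝ) :=
  Timed.tabulate (2 ^ k) fun i => Timed.tabulate d fun j => Timed.read x (finProdFinEquiv (i, j))

/-- The procedure on input `x`, when the random draw of the `k` maps has the outcome `φ`. -/
def singleSketch {d s k : ℕ} (φ : Fin k → Compression d s) (x : Fin (2 ^ k * d) → ℝ) :
    Timed (Fin d → ℝ) := do
  let φ ← pick φ
  let v ← partition x
  compress k φ v

end Sketch

end

/-! Stretch: unless its map fails on some pair, a level multiplies the sum of the squared block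
norms by a factor between 1 - ε and 1 + ε. All pairs of a level share one map, so a union bound
stands in for independence there; across levels, a map is independent of the vectors it meets, which
may thus be treated as fixed (`pi_fin_succ_le`). The 2^k - 1 < n pairs fail with total probability
at most n · n^(-(γ+1)) (`pi_compress_le`), and kε ≤ 1 turns (1 ± ε)^k into 1 ± kε (`stretch_of_sq`).
Time: fewer than 2^k applications, each of cost O(d (s + 1)).

Existence: view (A₀ A₁) as one sparse sign matrix. Its squared columns are deterministic, so the
distortion of a squared norm is an off-diagonal chaos in the signs. Integrating out the signs column
by column (`sum_exp_chaos_le`) bounds its exponential moment by that of an average of overlaps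
between two columns; Jensen reduces to a single pair, whose overlap is about s²/d
(`sum_exp_overlap_le`). Markov's inequality then gives the tail 2 exp(s²/(4d) - sε/8), and s ≈ εd/8
makes it small enough. Expectations appear as sums over all outcomes. -/

noncomputable section

namespace Sketch

/-! ### Values and running times of the timed procedures -/

namespace Timed

@[simp] theorem val_bind {α β : Type} (x : Timed α) (f : α → Timed β) :
    (x >>= f).val = (f x.val).val := rfl

@[simp] theorem steps_bind {α β : Type} (x : Timed α) (f : α → Timed β) :
    (x >>= f).steps = x.steps + (f x.val).steps := rfl

@[simp] theorem val_step {α : Type} (a : α) : (step a).val = a := rfl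

@[simp] theorem steps_step {α : Type} (a : α) : (step a).steps = 1 := rfl

theorem val_foldlM {α ι : Type} (f : α → ι → Timed α) (l : List ι) (z : α) :
    (l.foldlM (fun z i => do
      let z' ← f z i
      step z') z).val = l.foldl (fun z i => (f z i).val) z := by
  induction l generalizing z with
  | nil => rfl
  | cons a l ih => simp only [List.foldlM_cons, List.foldl_cons, val_bind, ih, val_step]

theorem steps_foldlM {α ι : Type} (f : α → ι → Timed α) (c : ℕ) (hf : ∀ z i, (f z i).steps = c)
    (l : List ι) (z : α) :
    (l.foldlM (fun z i => do
      let z' ← f z i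
      step z') z).steps = l.length * (c + 1) := by
  induction l generalizing z with
  | nil => exact (Nat.zero_mul _).symm
  | cons a l ih =>
    simp only [List.foldlM_cons, steps_bind, ih, steps_step, List.length_cons, hf]
    ring

theorem steps_loop {α : Type} {n c : ℕ} {z : α} {f : α → Fin n → Timed α}
    (hf : ∀ z i, (f z i).steps = c) : (loop n z f).steps = n * (c + 1) := by
  rw [loop, steps_foldlM f c hf, List.length_finRange]

theorem steps_tabulate {α : Type} {n c : ℕ} {f : Fin n → Timed α}
    (hf : ∀ i, (f i).steps = c) : (tabulate n f).steps = n * (c + 1) := by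
  simp [tabulate, hf]

theorem val_loop_add {M : Type} [AddCommMonoid M] {n : ℕ} {z : M} {f : M → Fin n → Timed M}
    {g : Fin n → M} (hf : ∀ z i, (f z i).val = z + g i) : (loop n z f).val = z + ∑ i, g i := by
  rw [loop, val_foldlM, Fin.sum_univ_def]
  simp only [hf]
  generalize List.finRange n = l
  induction l generalizing z with
  | nil => simp
  | cons a l ih => rw [List.foldl_cons, ih, List.map_cons, List.sum_cons, add_assoc]

end Timed

theorem steps_addProduct {d s : ℕ} (A : Fin d → Column d s) (x z : Fin d → ℝ) :
    (addProduct A x z).steps = d * (7 * s + 2) := by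
  have h : ∀ (z : Fin d → ℝ) (c : Fin d), (do
      let xc ← Timed.read x c
      Timed.loop s z fun z t => do
        let r ← Timed.read (A c).row t
        let a ← Timed.read (A c).coef t
        let p ← Timed.mul a xc
        let zr ← Timed.read z r
        let q ← Timed.add zr p
        Timed.write z r q : Timed (Fin d → ℝ)).steps = 7 * s + 1 := by
    intro z c
    -- Three reads, a product, a sum and a write per stored entry; the iteration is the seventh
    -- step.
    rw [Timed.steps_bind, Timed.steps_loop (c := 6) fun _ _ => rfl]
    simp only [Timed.read, Timed.steps_step]
    ring
  rw [addProduct, Timed.steps_loop h]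

theorem val_addProduct {d s : ℕ} (A : Fin d → Column d s) (x z : Fin d → ℝ) :
    (addProduct A x z).val = z + (toMatrix A).mulVec x := by
  rw [addProduct, Timed.val_loop_add
    -- Each write adds a multiple of a basis vector, so the loops accumulate a sum.
    (g := fun c => ∑ t, Pi.single ((A c).row t) ((A c).coef t * x c))]
  · congr 1
    ext r
    simp only [Finset.sum_apply, Matrix.mulVec, dotProduct, toMatrix, Matrix.of_apply,
      Finset.sum_mul, Pi.single_apply, ite_mul, zero_mul, eq_comm]
  · intro z c
    rw [Timed.val_bind, Timed.val_loop_add (g := fun t =>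
      Pi.single ((A c).row t) ((A c).coef t * x c))]
    intro z t
    ext r
    simp only [Timed.val_bind, Timed.read, Timed.mul, Timed.add, Timed.write, Timed.val_step,
      Pi.add_apply]
    rcases eq_or_ne r ((A c).row t) with rfl | h
    · simp
    · simp [h]

theorem steps_applyMap {d s : ℕ} (φ : Compression d s) (x y : Fin d → ℝ) :
    (applyMap φ x y).steps = d * (14 * s + 6) := by
  rw [applyMap, Timed.steps_bind, Timed.steps_tabulate (c := 1) fun _ => rfl, Timed.steps_bind,
    steps_addProduct, steps_addProduct]
  ring

theorem val_applyMap {d s : ℕ} (φ : Compression d s) (x y : Fin d → ℝ) :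
    (applyMap φ x y).val = φ.eval x y := by
  rw [applyMap, Timed.val_bind, Timed.val_bind, val_addProduct, val_addProduct, Compression.eval]
  have : (Timed.tabulate d fun _ => Timed.step (0 : ℝ)).val = 0 := rfl
  rw [this, zero_add]

/-- The index of the left member of the `j`-th pair. -/
def evenIndex {k : ℕ} (j : Fin (2 ^ k)) : Fin (2 ^ (k + 1)) :=
  ⟨2 * j, by have := j.isLt; rw [pow_succ]; omega⟩

/-- The index of the right member of the `j`-th pair. -/
def oddIndex {k : ℕ} (j : Fin (2 ^ k)) : Fin (2 ^ (k + 1)) :=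
  ⟨2 * j + 1, by have := j.isLt; rw [pow_succ]; omega⟩

theorem sum_even_odd {k : ℕ} (f : Fin (2 ^ (k + 1)) → ℝ) :
    ∑ i, f i = ∑ j : Fin (2 ^ k), (f (evenIndex j) + f (oddIndex j)) := by
  rw [← (finProdFinEquiv.trans (finCongr (pow_succ 2 k).symm)).sum_comp f, Fintype.sum_prod_type]
  refine Finset.sum_congr rfl fun j _ => ?_
  rw [Fin.sum_univ_two]
  congr 2 <;> ext <;> simp [evenIndex, oddIndex, finProdFinEquiv, add_comm]

/-- One level of the main loop. -/
def halve {d s k : ℕ} (φ : Compression d s) (v : Fin (2 ^ (k + 1)) → Fin d → ℝ) :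
    Fin (2 ^ k) → Fin d → ℝ :=
  fun j => φ.eval (v (evenIndex j)) (v (oddIndex j))

theorem val_compress_succ {d s k : ℕ} (φ : Fin (k + 1) → Compression d s)
    (v : Fin (2 ^ (k + 1)) → Fin d → ℝ) :
    (compress (k + 1) φ v).val = (compress k (fun i => φ i.succ) (halve (φ 0) v)).val := by
  rw [compress, Timed.val_bind]
  congr 2
  ext j : 1
  exact val_applyMap _ _ _

/-- The 2^k - 1 applications, each with its loop iteration, are followed by one final read; the cost
of one application is moved to the left to avoid subtraction. -/
theorem steps_compress {d s k : ℕ} (φ : Fin k → Compression d s) (v : Fin (2 ^ k) → Fin d → ℝ) :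
    (compress k φ v).steps + (d * (14 * s + 6) + 1) = 2 ^ k * (d * (14 * s + 6) + 1) + 1 := by
  induction k with
  | zero =>
    have : (compress 0 φ v).steps = 1 := rfl
    rw [this]
    ring
  | succ k ih =>
    rw [compress, Timed.steps_bind, Timed.steps_tabulate fun _ => steps_applyMap _ _ _, add_assoc,
      ih, pow_succ]
    ring

/-- Drawing the maps costs 6kds + 2, which k ≤ 2^k makes comparable to applying them. -/
theorem steps_singleSketch {d s k : ℕ} (φ : Fin k → Compression d s) (x : Fin (2 ^ k * d) → ℝ)
    (hd : 1 ≤ d) : (singleSketch φ x).steps ≤ 2 ^ k * d * (20 * s + 13) := by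
  have hp : (partition x).steps = 2 ^ k * (d * 2 + 1) :=
    Timed.steps_tabulate fun _ => Timed.steps_tabulate fun _ => rfl
  have hc := steps_compress φ (partition x).val
  have hk : k ≤ 2 ^ k := Nat.lt_two_pow_self.le
  have hs : (singleSketch φ x).steps =
      (2 + 3 * (k * (2 * d * s))) + ((partition x).steps +
        (compress k φ (partition x).val).steps) := rfl
  have h1 : k * (d * s) ≤ 2 ^ k * (d * s) := Nat.mul_le_mul_right _ hk
  have h2 : 2 ^ k * 1 ≤ 2 ^ k * d := Nat.mul_le_mul_left _ hd
  have h3 : 1 ≤ 2 ^ k := Nat.one_le_two_pow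
  rw [hs, hp]
  nlinarith

/-! ### Linearity -/

theorem isLinearMap_eval {d s : ℕ} {M : Type} [AddCommMonoid M] [Module ℝ M]
    (φ : Compression d s) {f g : M → Fin d → ℝ} (hf : IsLinearMap ℝ f) (hg : IsLinearMap ℝ g) :
    IsLinearMap ℝ fun x => φ.eval (f x) (g x) where
  map_add x y := by
    simp only [Compression.eval, hf.map_add, hg.map_add, Matrix.mulVec_add]
    abel
  map_smul c x := by
    simp only [Compression.eval, hf.map_smul, hg.map_smul, Matrix.mulVec_smul, smul_add]

theorem isLinearMap_compress {d s k : ℕ} {M : Type} [AddCommMonoid M] [Module ℝ M]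
    (φ : Fin k → Compression d s) (v : M → Fin (2 ^ k) → Fin d → ℝ)
    (hv : ∀ j, IsLinearMap ℝ fun x => v x j) :
    IsLinearMap ℝ fun x => (compress k φ (v x)).val := by
  induction k with
  | zero => exact hv _
  | succ k ih =>
    simp only [val_compress_succ]
    exact ih _ _ fun j => isLinearMap_eval _ (hv _) (hv _)

theorem isLinearMap_singleSketch {d s k : ℕ} (φ : Fin k → Compression d s) :
    IsLinearMap ℝ fun x : Fin (2 ^ k * d) → ℝ => (singleSketch φ x).val :=
  isLinearMap_compress φ (fun x => (partition x).val) fun _ =>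
    ⟨fun _ _ => rfl, fun _ _ => rfl⟩

/-! ### Stretch -/

theorem norm2_sq {n : ℕ} (x : Fin n → ℝ) : norm2 x ^ 2 = ∑ i, x i ^ 2 := by
  simp [norm2, EuclideanSpace.norm_sq_eq]

theorem norm2_nonneg {n : ℕ} (x : Fin n → ℝ) : 0 ≤ norm2 x := norm_nonneg _

theorem sum_norm2_sq_partition {d k : ℕ} (x : Fin (2 ^ k * d) → ℝ) :
    ∑ i, norm2 ((partition x).val i) ^ 2 = norm2 x ^ 2 := by
  simp only [norm2_sq]
  rw [← finProdFinEquiv.sum_comp, Fintype.sum_prod_type]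
  rfl

instance (d s : ℕ) : Finite (Column d s) :=
  Finite.of_injective (fun a : Column d s => (a.row, a.sign)) fun a b h => by
    ext1
    · exact congrArg Prod.fst h
    · exact congrArg Prod.snd h

instance (d s : ℕ) : Finite (Compression d s) :=
  Finite.of_injective (fun a : Compression d s => (a.left, a.right)) fun a b h => by
    ext1
    · exact congrArg Prod.fst h
    · exact congrArg Prod.snd h

instance (d s : ℕ) : DiscreteMeasurableSpace (Compression d s) := ⟨fun _ => trivial⟩

/-- Fubini: given the first map, the others still follow the product law, so a bound uniform in the
first map survives averaging. -/
theorem pi_fin_succ_le {α : Type} [MeasurableSpace α] [Finite α] [DiscreteMeasurableSpace α]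
    (F : Measure α) [IsProbabilityMeasure F] {k : ℕ} (S : α → Set (Fin k → α)) (c : ℝ)
    (hS : ∀ a, (Measure.pi fun _ : Fin k => F).real (S a) ≤ c) :
    (Measure.pi fun _ : Fin (k + 1) => F).real {φ | (fun i => φ i.succ) ∈ S (φ 0)} ≤ c := by
  have hpre := measurePreserving_piFinSuccAbove (fun _ : Fin (k + 1) => F) 0
  have hset : {φ : Fin (k + 1) → α | (fun i => φ i.succ) ∈ S (φ 0)} =
      MeasurableEquiv.piFinSuccAbove (fun _ : Fin (k + 1) => α) 0 ⁻¹' {p | p.2 ∈ S p.1} := by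
    ext φ
    rfl
  have hm : MeasurableSet {p : α × (Fin k → α) | p.2 ∈ S p.1} := .of_discrete
  have hc : 0 ≤ c := by
    obtain ⟨a⟩ : Nonempty α := nonempty_of_isProbabilityMeasure F
    exact measureReal_nonneg.trans (hS a)
  rw [hset, measureReal_def, hpre.measure_preimage hm.nullMeasurableSet]
  refine ENNReal.toReal_le_of_le_ofReal hc ?_
  rw [Measure.prod_apply hm]
  calc _ ≤ ∫⁻ _, ENNReal.ofReal c ∂F := by
        refine lintegral_mono fun a => ?_
        rw [ENNReal.le_ofReal_iff_toReal_le (measure_ne_top _ _) hc]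
        exact hS a
    _ = ENNReal.ofReal c := by simp

theorem pi_compress_le {d s : ℕ} (F : Measure (Compression d s)) [IsProbabilityMeasure F]
    {ε δ : ℝ} (hε : 0 ≤ ε) (hε1 : ε ≤ 1)
    (hF : ∀ x y : Fin d → ℝ, F.real {φ : Compression d s |
      ¬ ((1 - ε) * (norm2 x ^ 2 + norm2 y ^ 2) ≤ norm2 (φ.eval x y) ^ 2 ∧
      norm2 (φ.eval x y) ^ 2 ≤ (1 + ε) * (norm2 x ^ 2 + norm2 y ^ 2))} ≤ δ)
    (k : ℕ) (v : Fin (2 ^ k) → Fin d → ℝ) :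
    (Measure.pi fun _ : Fin k => F).real {φ |
      ¬ ((1 - ε) ^ k * ∑ j, norm2 (v j) ^ 2 ≤ norm2 (compress k φ v).val ^ 2 ∧
        norm2 (compress k φ v).val ^ 2 ≤ (1 + ε) ^ k * ∑ j, norm2 (v j) ^ 2)} ≤
      (2 ^ k - 1) * δ := by
  induction k with
  | zero =>
    have h : ∀ φ : Fin 0 → Compression d s, (compress 0 φ v).val = v 0 := fun _ => rfl
    simp [h]
  | succ k ih =>
    set μ := Measure.pi fun _ : Fin (k + 1) => F
    let B : Fin (2 ^ k) → Set (Compression d s) := fun j => {φ |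
      ¬ ((1 - ε) * (norm2 (v (evenIndex j)) ^ 2 + norm2 (v (oddIndex j)) ^ 2) ≤
          norm2 (halve φ v j) ^ 2 ∧
        norm2 (halve φ v j) ^ 2 ≤
          (1 + ε) * (norm2 (v (evenIndex j)) ^ 2 + norm2 (v (oddIndex j)) ^ 2))}
    let S : Compression d s → Set (Fin k → Compression d s) := fun a => {φ |
      ¬ ((1 - ε) ^ k * ∑ j, norm2 (halve a v j) ^ 2 ≤ norm2 (compress k φ (halve a v)).val ^ 2 ∧
        norm2 (compress k φ (halve a v)).val ^ 2 ≤ (1 + ε) ^ k * ∑ j, norm2 (halve a v j) ^ 2)}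
    have hsub : {φ | ¬ ((1 - ε) ^ (k + 1) * ∑ j, norm2 (v j) ^ 2 ≤
          norm2 (compress (k + 1) φ v).val ^ 2 ∧
        norm2 (compress (k + 1) φ v).val ^ 2 ≤ (1 + ε) ^ (k + 1) * ∑ j, norm2 (v j) ^ 2)} ⊆
        -- Failure requires the first map to fail on some pair, or the later maps to fail on the
        -- vectors that it produces.
        (⋃ j, Function.eval 0 ⁻¹' B j) ∪ {φ | (fun i => φ i.succ) ∈ S (φ 0)} := by
      intro φ hφ
      by_contra hcon
      simp only [Set.mem_union, Set.mem_iUnion, Set.mem_preimage, Function.eval, not_or,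
        not_exists, B, S, Set.mem_ofPred_eq, not_not] at hcon
      obtain ⟨h0, h1, h2⟩ := hcon
      apply hφ
      rw [val_compress_succ, sum_even_odd]
      have hl : (1 - ε) * ∑ j : Fin (2 ^ k),
          (norm2 (v (evenIndex j)) ^ 2 + norm2 (v (oddIndex j)) ^ 2) ≤
          ∑ j, norm2 (halve (φ 0) v j) ^ 2 := by
        rw [Finset.mul_sum]
        exact Finset.sum_le_sum fun j _ => (h0 j).1
      have hu : ∑ j, norm2 (halve (φ 0) v j) ^ 2 ≤ (1 + ε) * ∑ j : Fin (2 ^ k),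
          (norm2 (v (evenIndex j)) ^ 2 + norm2 (v (oddIndex j)) ^ 2) := by
        rw [Finset.mul_sum]
        exact Finset.sum_le_sum fun j _ => (h0 j).2
      rw [pow_succ (1 - ε), pow_succ (1 + ε), mul_assoc, mul_assoc]
      exact ⟨(mul_le_mul_of_nonneg_left hl (pow_nonneg (by linarith) k)).trans h1,
        h2.trans (mul_le_mul_of_nonneg_left hu (pow_nonneg (by linarith) k))⟩
    have hB : ∀ j, μ.real (Function.eval 0 ⁻¹' B j) ≤ δ := by
      intro j
      have := (measurePreserving_eval (fun _ : Fin (k + 1) => F) 0).measure_preimage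
        (MeasurableSet.of_discrete (s := B j)).nullMeasurableSet
      rw [measureReal_def, this]
      exact hF _ _
    calc _ ≤ μ.real ((⋃ j, Function.eval 0 ⁻¹' B j) ∪ {φ | (fun i => φ i.succ) ∈ S (φ 0)}) :=
          measureReal_mono hsub
      _ ≤ μ.real (⋃ j, Function.eval 0 ⁻¹' B j) + μ.real {φ | (fun i => φ i.succ) ∈ S (φ 0)} :=
          measureReal_union_le _ _
      -- There are 2^k pairs at this level and 2^k - 1 at the later ones.
      _ ≤ ∑ j : Fin (2 ^ k), δ + (2 ^ k - 1) * δ := by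
          gcongr
          · exact (measureReal_iUnion_fintype_le _).trans (Finset.sum_le_sum fun j _ => hB j)
          · exact pi_fin_succ_le F S _ fun a => ih (halve a v)
      _ = (2 ^ (k + 1) - 1) * δ := by
          simp
          ring

/-- With u = kε ≤ 1, Bernoulli gives (1 - ε)^k ≥ 1 - u ≥ (1 - u)², and (1 + ε)^k ≤ exp u ≤ 1 + u +
u² ≤ (1 + u)². -/
theorem stretch_of_sq {k : ℕ} {ε a b : ℝ} (ha : 0 ≤ a) (hb : 0 ≤ b) (hε : 0 ≤ ε) (hε1 : ε ≤ 1)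
    (hk : k * ε ≤ 1) (hl : (1 - ε) ^ k * a ^ 2 ≤ b ^ 2) (hu : b ^ 2 ≤ (1 + ε) ^ k * a ^ 2) :
    (1 - k * ε) * a ≤ b ∧ b ≤ (1 + k * ε) * a := by
  have hkε : 0 ≤ k * ε := by positivity
  have h1 : 1 - k * ε ≤ (1 - ε) ^ k := by
    have := one_add_mul_le_pow (a := -ε) (by linarith) k
    rw [← sub_eq_add_neg] at this
    linarith
  have h2 : (1 + ε) ^ k ≤ (1 + k * ε) ^ 2 := by
    have he : (1 + ε) ^ k ≤ Real.exp (k * ε) := by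
      rw [Real.exp_nat_mul]
      gcongr
      linarith [Real.add_one_le_exp ε]
    have := (abs_le.1 (Real.abs_exp_sub_one_sub_id_le (x := k * ε) (by rwa [abs_of_nonneg hkε]))).2
    nlinarith
  constructor
  · refine le_of_sq_le_sq ?_ hb
    have : (1 - k * ε) ^ 2 ≤ 1 - k * ε := by nlinarith
    rw [mul_pow]
    exact (mul_le_mul_of_nonneg_right (this.trans h1) (sq_nonneg a)).trans hl
  · refine le_of_sq_le_sq ?_ (by positivity)
    rw [mul_pow]
    exact hu.trans (mul_le_mul_of_nonneg_right h2 (sq_nonneg a))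

theorem IsCompressionLaw.pi_singleSketch_ge {d s : ℕ} {F : Measure (Compression d s)} {ε δ : ℝ}
    (hF : IsCompressionLaw F ε δ) (hε : 0 ≤ ε) (hε1 : ε ≤ 1) (hδ : 0 ≤ δ) {k : ℕ}
    (hk : k * ε ≤ 1) (x : Fin (2 ^ k * d) → ℝ) :
    1 - 2 ^ k * δ ≤ (Measure.pi fun _ : Fin k => F).real {φ |
      (1 - k * ε) * norm2 x ≤ norm2 (singleSketch φ x).val ∧
        norm2 (singleSketch φ x).val ≤ (1 + k * ε) * norm2 x} := by
  have := hF.isProbabilityMeasure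
  have hbad := pi_compress_le F hε hε1 (δ := δ) (fun x y => by
    have h := hF.preserves x y
    rw [← Set.compl_ofPred, probReal_compl_eq_one_sub .of_discrete]
    linarith) k (partition x).val
  rw [sum_norm2_sq_partition, ← Set.compl_ofPred, probReal_compl_eq_one_sub .of_discrete] at hbad
  have hmono : (Measure.pi fun _ : Fin k => F).real {φ |
      (1 - ε) ^ k * norm2 x ^ 2 ≤ norm2 (compress k φ (partition x).val).val ^ 2 ∧
        norm2 (compress k φ (partition x).val).val ^ 2 ≤ (1 + ε) ^ k * norm2 x ^ 2} ≤
      (Measure.pi fun _ : Fin k => F).real {φ |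
      (1 - k * ε) * norm2 x ≤ norm2 (singleSketch φ x).val ∧
        norm2 (singleSketch φ x).val ≤ (1 + k * ε) * norm2 x} :=
    measureReal_mono fun φ hφ =>
      stretch_of_sq (norm2_nonneg x) (norm2_nonneg _) hε hε1 hk hφ.1 hφ.2
  linarith

/-! ### Exponential moments of sparse sign matrices -/

/-- The sign `± 1` encoded by a Boolean. -/
def sgn (b : Bool) : ℝ := if b then 1 else -1

/-- Independent signs factor the sum, and cosh b ≤ exp(b²/2) bounds each factor. -/
theorem sum_exp_sgn_le {s : ℕ} (b : Fin s → ℝ) :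
    ∑ σ : Fin s → Bool, Real.exp (∑ t, b t * sgn (σ t)) ≤
      2 ^ s * Real.exp (∑ t, b t ^ 2 / 2) := by
  simp only [Real.exp_sum]
  have h := Finset.prod_univ_sum (fun _ : Fin s => (Finset.univ : Finset Bool))
    fun t c => Real.exp (b t * sgn c)
  rw [Fintype.piFinset_univ] at h
  rw [← h]
  have hs : (2 : ℝ) ^ s = ∏ _t : Fin s, 2 := by simp
  rw [hs, ← Finset.prod_mul_distrib]
  refine Finset.prod_le_prod (fun t _ => Finset.sum_nonneg fun _ _ => (Real.exp_pos _).le)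
    fun t _ => ?_
  have := Real.cosh_le_exp_half_sq (b t)
  rw [Real.cosh_eq] at this
  simp only [Fintype.sum_bool, sgn, if_true, Bool.false_eq_true, if_false, mul_one, mul_neg]
  linarith

/-- The number (`0` or `1`) of stored entries of a column in row `r`. -/
def hit {d s : ℕ} (ρ : Fin s ↪ Fin d) (r : Fin d) : ℝ := ∑ t, if ρ t = r then 1 else 0

/-- The sign of a column in row `r`, and `0` if there is no stored entry in that row. -/
def entry {d s : ℕ} (ρ : Fin s ↪ Fin d) (σ : Fin s → Bool) (r : Fin d) : ℝ :=
  ∑ t, if ρ t = r then sgn (σ t) else 0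

theorem hit_eq_zero_or_one {d s : ℕ} (ρ : Fin s ↪ Fin d) (r : Fin d) :
    hit ρ r = 0 ∨ hit ρ r = 1 := by
  by_cases h : ∃ t, ρ t = r
  · obtain ⟨t, rfl⟩ := h
    right
    simp [hit]
  · left
    push Not at h
    simp [hit, h]

theorem hit_nonneg {d s : ℕ} (ρ : Fin s ↪ Fin d) (r : Fin d) : 0 ≤ hit ρ r := by
  rcases hit_eq_zero_or_one ρ r with h | h <;> rw [h]
  exact zero_le_one

theorem hit_le_one {d s : ℕ} (ρ : Fin s ↪ Fin d) (r : Fin d) : hit ρ r ≤ 1 := by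
  rcases hit_eq_zero_or_one ρ r with h | h <;> rw [h]
  exact zero_le_one

/-- A row is stored at most once per column, so squaring forgets the sign: the diagonal of the chaos
is not random. -/
theorem entry_sq {d s : ℕ} (ρ : Fin s ↪ Fin d) (σ : Fin s → Bool) (r : Fin d) :
    entry ρ σ r ^ 2 = hit ρ r := by
  by_cases h : ∃ t, ρ t = r
  · obtain ⟨t, rfl⟩ := h
    cases hσ : σ t <;> simp [hit, entry, sgn, hσ]
  · push Not at h
    simp [hit, entry, h]

theorem sum_mul_hit {d s : ℕ} (ρ : Fin s ↪ Fin d) (f : Fin d → ℝ) :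
    ∑ r, f r * hit ρ r = ∑ t, f (ρ t) := by
  simp only [hit, Finset.mul_sum]
  rw [Finset.sum_comm]
  simp

theorem sum_hit {d s : ℕ} (ρ : Fin s ↪ Fin d) : ∑ r, hit ρ r = s := by
  simpa using sum_mul_hit ρ 1

theorem sum_mul_entry {d s : ℕ} (ρ : Fin s ↪ Fin d) (σ : Fin s → Bool) (f : Fin d → ℝ) :
    ∑ r, f r * entry ρ σ r = ∑ t, f (ρ t) * sgn (σ t) := by
  simp only [entry, Finset.mul_sum]
  rw [Finset.sum_comm]
  simp

/-- Exponential moments of the weighted off-diagonal quadratic chaos of a sparse sign matrix,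
over the signs, for fixed positions. -/
theorem sum_exp_chaos_le {d s : ℕ} {T : ℝ} (N : ℕ) (y : Fin N → ℝ)
    (ρ : Fin N → Fin s ↪ Fin d) (τ : Fin d → ℝ)
    (hτ : ∀ r, |τ r| ≤ T - 2 * T ^ 2 * ∑ i, hit (ρ i) r * y i ^ 2) :
    ∑ σ : Fin N → Fin s → Bool, Real.exp (∑ r, τ r *
      ((∑ i, y i * entry (ρ i) (σ i) r) ^ 2 - ∑ i, hit (ρ i) r * y i ^ 2)) ≤
    (2 ^ s) ^ N * Real.exp (T ^ 2 * ∑ r, ((∑ i, hit (ρ i) r * y i ^ 2) ^ 2 -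
      ∑ i, (hit (ρ i) r * y i ^ 2) ^ 2)) := by
  -- Integrating out one column changes the weights row by row, hence the row-dependent `τ`. The
  -- bound on |τ| is a budget from which each column consumes 2T² times its share of the row.
  induction N generalizing τ with
  | zero => simp
  | succ N ih =>
    set A : Fin d → ℝ := fun r => ∑ i : Fin N, hit (ρ i.succ) r * y i.succ ^ 2 with hA
    set D : Fin d → ℝ := fun r => ∑ i : Fin N, (hit (ρ i.succ) r * y i.succ ^ 2) ^ 2 with hD
    set a : Fin d → ℝ := fun r => hit (ρ 0) r * y 0 ^ 2 with ha
    have hA0 : ∀ r, 0 ≤ A r := fun r =>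
      Finset.sum_nonneg fun i _ => mul_nonneg (hit_nonneg _ _) (sq_nonneg _)
    have ha0 : ∀ r, 0 ≤ a r := fun r => mul_nonneg (hit_nonneg _ _) (sq_nonneg _)
    have hτ' : ∀ r, |τ r| ≤ T - 2 * T ^ 2 * (a r + A r) := fun r => by
      simpa only [Fin.sum_univ_succ] using hτ r
    have hτT : ∀ r, τ r ^ 2 ≤ T ^ 2 := fun r => by
      refine sq_le_sq' ?_ ?_ <;>
      nlinarith [hτ' r, abs_le.1 (le_refl |τ r|), mul_nonneg (sq_nonneg T) (hA0 r),
        mul_nonneg (sq_nonneg T) (ha0 r)]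
    -- The new weight grows by at most 2 T² a, exactly what removing column 0 releases from the
    -- budget.
    have hstep := ih (fun i => y i.succ) (fun i => ρ i.succ)
      (fun r => τ r + 2 * a r * τ r ^ 2) (fun r => by
        have h1 := abs_add_le (τ r) (2 * a r * τ r ^ 2)
        rw [abs_of_nonneg (by have := ha0 r; positivity : 0 ≤ 2 * a r * τ r ^ 2)] at h1
        change _ ≤ T - 2 * T ^ 2 * A r
        nlinarith [hτ' r, mul_le_mul_of_nonneg_left (hτT r) (ha0 r)])
    rw [← (Fin.consEquiv fun _ : Fin (N + 1) => Fin s → Bool).sum_comp,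
      Fintype.sum_prod_type_right]
    simp only [Fin.consEquiv_apply, Fin.sum_univ_succ, Fin.cons_zero, Fin.cons_succ]
    have hinner : ∀ σ : Fin N → Fin s → Bool,
        ∑ σ₀ : Fin s → Bool, Real.exp (∑ r, τ r *
          ((y 0 * entry (ρ 0) σ₀ r + ∑ i : Fin N, y i.succ * entry (ρ i.succ) (σ i) r) ^ 2 -
            (a r + A r))) ≤
        2 ^ s * (Real.exp (∑ r, (τ r + 2 * a r * τ r ^ 2) *
          ((∑ i : Fin N, y i.succ * entry (ρ i.succ) (σ i) r) ^ 2 - A r)) *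
            Real.exp (T ^ 2 * ∑ r, 2 * a r * A r)) := by
      intro σ
      set S : Fin d → ℝ := fun r => ∑ i : Fin N, y i.succ * entry (ρ i.succ) (σ i) r with hS
      -- The square of the entry of column 0 cancels against `a r`; only a term linear in its signs
      -- remains.
      have hsplit : ∀ σ₀ : Fin s → Bool,
          ∑ r, τ r * ((y 0 * entry (ρ 0) σ₀ r + S r) ^ 2 - (a r + A r)) =
          ∑ r, τ r * (S r ^ 2 - A r) + ∑ t, (2 * y 0 * τ (ρ 0 t) * S (ρ 0 t)) * sgn (σ₀ t) := by
        intro σ₀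
        rw [← sum_mul_entry (ρ 0) σ₀ fun r => 2 * y 0 * τ r * S r, ← Finset.sum_add_distrib]
        refine Finset.sum_congr rfl fun r _ => ?_
        simp only [ha, ← entry_sq (ρ 0) σ₀ r]
        ring
      change ∑ σ₀ : Fin s → Bool, Real.exp
          (∑ r, τ r * ((y 0 * entry (ρ 0) σ₀ r + S r) ^ 2 - (a r + A r))) ≤ _
      simp only [hsplit, Real.exp_add, ← Finset.mul_sum]
      refine (mul_le_mul_of_nonneg_left (sum_exp_sgn_le _) (Real.exp_pos _).le).trans ?_
      rw [mul_left_comm, ← Real.exp_add, ← Real.exp_add]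
      refine mul_le_mul_of_nonneg_left (Real.exp_le_exp.2 ?_) (by positivity)
      rw [← sum_mul_hit (ρ 0) fun r => (2 * y 0 * τ r * S r) ^ 2 / 2, Finset.mul_sum,
        ← Finset.sum_add_distrib, ← Finset.sum_add_distrib]
      refine Finset.sum_le_sum fun r _ => ?_
      -- The sign average yields 2aτ²S² = 2aτ²(S² - A) + 2aτ²A: the first part updates the weight,
      -- the second is at most 2T²aA.
      have h := mul_le_mul_of_nonneg_right (hτT r) (mul_nonneg (ha0 r) (hA0 r))
      simp only [ha] at h ⊢
      linarith
    calc _ ≤ ∑ σ : Fin N → Fin s → Bool, 2 ^ s * (Real.exp (∑ r, (τ r + 2 * a r * τ r ^ 2) *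
          ((∑ i : Fin N, y i.succ * entry (ρ i.succ) (σ i) r) ^ 2 - A r)) *
            Real.exp (T ^ 2 * ∑ r, 2 * a r * A r)) := Finset.sum_le_sum fun σ _ => hinner σ
      _ ≤ 2 ^ s * ((2 ^ s) ^ N * Real.exp (T ^ 2 * ∑ r, (A r ^ 2 - D r)) *
            Real.exp (T ^ 2 * ∑ r, 2 * a r * A r)) := by
          rw [← Finset.mul_sum, ← Finset.sum_mul]
          gcongr
      _ = (2 ^ s) ^ (N + 1) * Real.exp (T ^ 2 * ∑ r, ((a r + A r) ^ 2 - (a r ^ 2 + D r))) := by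
          rw [mul_assoc, ← Real.exp_add, ← mul_add, ← Finset.sum_add_distrib, ← mul_assoc,
            ← pow_succ']
          congr 3
          refine Finset.sum_congr rfl fun r _ => ?_
          ring

/-! ### Overlaps of random positions -/

/-- Sampling without replacement: given the other m positions, the last is uniform on their
complement, where W averages at most c. -/
theorem sum_embedding_prod_le {d : ℕ} {W : Fin d → ℝ} {c : ℝ} (hW : ∀ r, 0 ≤ W r) (hc : 0 ≤ c)
    (m : ℕ) (hU : ∀ U : Finset (Fin d), d < U.card + m → ∑ r ∈ U, W r ≤ U.card * c) :
    ∑ e : Fin m ↪ Fin d, ∏ t, W (e t) ≤ Fintype.card (Fin m ↪ Fin d) * c ^ m := by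
  induction m with
  | zero => simp
  | succ m ih =>
    classical
    have ih' := ih fun U h => hU U (by omega)
    have hcard : ∀ e : Fin m ↪ Fin d, (Fintype.card {i // i ∉ Set.range e} : ℝ) = (d - m : ℕ) := by
      intro e
      have h : Fintype.card (Fin m) = Fintype.card {i // i ∈ Set.range e} :=
        Fintype.card_congr (Equiv.ofInjective e e.injective)
      rw [Fintype.card_subtype_compl, ← h, Fintype.card_fin, Fintype.card_fin]
    rw [Fintype.card_congr (Equiv.embeddingFinSucc m (Fin d)), Fintype.card_sigma,
      ← (Equiv.embeddingFinSucc m (Fin d)).symm.sum_comp, Fintype.sum_sigma]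
    simp only [Equiv.coe_embeddingFinSucc_symm, Fin.prod_univ_succ, Fin.cons_zero, Fin.cons_succ,
      ← Finset.sum_mul]
    push_cast
    simp only [hcard, Finset.sum_const, nsmul_eq_mul, Finset.card_univ]
    rcases le_or_gt d m with hdm | hdm
    · refine le_of_eq_of_le (Finset.sum_eq_zero fun e _ => ?_) (by positivity)
      have : IsEmpty {i // i ∉ Set.range e} := by
        rw [← Fintype.card_eq_zero_iff]
        have := hcard e
        rw [Nat.sub_eq_zero_of_le hdm] at this
        exact_mod_cast this
      simp
    calc _ ≤ ∑ e : Fin m ↪ Fin d, ((d - m : ℕ) * c) * ∏ t, W (e t) := by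
          refine Finset.sum_le_sum fun e _ => mul_le_mul_of_nonneg_right ?_
            (Finset.prod_nonneg fun t _ => hW _)
          have hc' : (Finset.univ.filter fun i => i ∉ Set.range e).card = d - m := by
            rw [← Fintype.card_subtype]
            exact_mod_cast hcard e
          have := hU (Finset.univ.filter fun i => i ∉ Set.range e) (by omega)
          rw [hc'] at this
          rwa [← Finset.sum_subtype (Finset.univ.filter fun i => i ∉ Set.range e) (by simp) W]
      _ ≤ ((d - m : ℕ) * c) * (Fintype.card (Fin m ↪ Fin d) * c ^ m) := by
          rw [← Finset.mul_sum]
          gcongr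
      _ = _ := by ring

/-- As exp(h/16) ≤ 1 + h/8 for 0 ≤ h ≤ 1 and at least half of the rows stay available (2s ≤ d), each
draw contributes a factor at most 1 + s/(4d). -/
theorem sum_exp_overlap_le {d s : ℕ} (hs : 2 * s ≤ d) (e : Fin s ↪ Fin d) :
    ∑ e' : Fin s ↪ Fin d, Real.exp ((∑ r, hit e r * hit e' r) / 16) ≤
      Fintype.card (Fin s ↪ Fin d) * Real.exp ((s : ℝ) ^ 2 / (4 * d)) := by
  have hsd : (2 * s : ℝ) ≤ d := by exact_mod_cast hs
  have h := sum_embedding_prod_le (W := fun r => Real.exp (hit e r / 16))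
    (c := 1 + s / (4 * d)) (fun r => (Real.exp_pos _).le) (by positivity) s (by
      intro U hU
      have hd : (0 : ℝ) < d := by
        rcases Nat.eq_zero_or_pos d with rfl | h
        · have : U.card ≤ 0 := by simpa using Finset.card_le_univ U
          omega
        · exact_mod_cast h
      have hU2 : (d : ℝ) ≤ 2 * U.card := by
        have : d ≤ 2 * U.card := by omega
        exact_mod_cast this
      calc ∑ r ∈ U, Real.exp (hit e r / 16) ≤ ∑ r ∈ U, (1 + hit e r / 8) := by
            refine Finset.sum_le_sum fun r _ => ?_
            have h0 := hit_nonneg e r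
            have h1 := hit_le_one e r
            have := (abs_le.1 (Real.abs_exp_sub_one_sub_id_le (x := hit e r / 16)
              (by rw [abs_of_nonneg] <;> linarith))).2
            nlinarith
        _ ≤ U.card + s / 8 := by
            rw [Finset.sum_add_distrib, ← Finset.sum_div]
            have := Finset.sum_le_univ_sum_of_nonneg (s := U) (hit_nonneg e)
            rw [sum_hit] at this
            simp
            linarith
        _ ≤ U.card * (1 + s / (4 * d)) := by
            rw [mul_add, mul_one]
            gcongr
            rw [← mul_div_assoc, div_le_div_iff₀ (by norm_num) (by positivity)]
            nlinarith [mul_le_mul_of_nonneg_right hU2 (Nat.cast_nonneg (α := ℝ) s)])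
  simp only [← Real.exp_sum, ← Finset.sum_div, ← sum_mul_hit] at h
  refine h.trans ?_
  gcongr
  calc (1 + s / (4 * d) : ℝ) ^ s ≤ Real.exp (s / (4 * d)) ^ s := by
        gcongr
        linarith [Real.add_one_le_exp ((s : ℝ) / (4 * d))]
    _ = Real.exp ((s : ℝ) ^ 2 / (4 * d)) := by
        rw [← Real.exp_nat_mul]
        congr 1
        ring

/-- Independence of two coordinates: fix all but the j-th and average over that one. -/
theorem sum_pi_pair_le {ι β : Type} [Fintype ι] [DecidableEq ι] [Fintype β] {i j : ι}
    (hij : i ≠ j) (f : β → β → ℝ) {B : ℝ} (hf : ∀ b, ∑ b', f b b' ≤ Fintype.card β * B) :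
    ∑ ρ : ι → β, f (ρ i) (ρ j) ≤ Fintype.card (ι → β) * B := by
  rw [Fintype.card_congr (Equiv.funSplitAt j β), Fintype.card_prod,
    ← (Equiv.funSplitAt j β).symm.sum_comp, Fintype.sum_prod_type_right]
  calc _ = ∑ g : {i // i ≠ j} → β, ∑ b', f (g ⟨i, hij⟩) b' := by
        simp [Equiv.funSplitAt, Equiv.piSplitAt, hij]
    _ ≤ ∑ g : {i // i ≠ j} → β, Fintype.card β * B := Finset.sum_le_sum fun g _ => hf _
    _ = _ := by
        simp
        ring

/-! ### Sparse sign matrices preserve norms -/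

/-- Exponential moments of the distortion of a sparse sign matrix. -/
theorem sum_exp_distortion_le {d s N : ℕ} (hs0 : 0 < s) (hs : 2 * s ≤ d) (x : Fin N → ℝ) {t : ℝ}
    (hx : 0 < ∑ i, x i ^ 2) (ht : |t| = s / (8 * ∑ i, x i ^ 2)) :
    ∑ p : (Fin N → Fin s ↪ Fin d) × (Fin N → Fin s → Bool),
      Real.exp (t * (∑ r, (∑ i, x i / √s * entry (p.1 i) (p.2 i) r) ^ 2 - ∑ i, x i ^ 2)) ≤
    Fintype.card ((Fin N → Fin s ↪ Fin d) × (Fin N → Fin s → Bool)) *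
      Real.exp ((s : ℝ) ^ 2 / (4 * d)) := by
  have hsR : (0 : ℝ) < s := by exact_mod_cast hs0
  set X := ∑ i, x i ^ 2 with hX
  have hy : ∀ i, (x i / √s) ^ 2 = x i ^ 2 / s := fun i => by
    rw [div_pow, Real.sq_sqrt hsR.le]
  set w : Fin N → Fin N → ℝ := fun i j => (x i ^ 2 / X) * (x j ^ 2 / X) with hw
  have hw0 : ∀ i j, 0 ≤ w i j := fun i j => by positivity
  have hw1 : ∑ q : Fin N × Fin N, w q.1 q.2 = 1 := by
    rw [Fintype.sum_prod_type]
    simp only [hw, ← Finset.mul_sum, ← Finset.sum_div, ← hX, div_self hx.ne',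
      mul_one]
  let Q : (Fin N → Fin s ↪ Fin d) → Fin N → Fin N → ℝ := fun ρ i j =>
    if i = j then 0 else (∑ r, hit (ρ i) r * hit (ρ j) r) / 16
  have hsigns : ∀ ρ : Fin N → Fin s ↪ Fin d, ∑ σ : Fin N → Fin s → Bool,
      Real.exp (t * (∑ r, (∑ i, x i / √s * entry (ρ i) (σ i) r) ^ 2 - X)) ≤
      (2 ^ s) ^ N * ∑ q : Fin N × Fin N, w q.1 q.2 * Real.exp (Q ρ q.1 q.2) := by
    intro ρ
    -- Row sums of hit · y² are at most X/s, and this T maximizes T - 2T²X/s; the maximum s/(8X) is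
    -- the prescribed |t|.
    have h := sum_exp_chaos_le (T := s / (4 * X)) N (fun i => x i / √s) ρ
      (fun _ => t) (fun r => by
        have h1 : ∑ i, hit (ρ i) r * (x i / √s) ^ 2 ≤ X / s := by
          rw [hX, Finset.sum_div]
          refine Finset.sum_le_sum fun i _ => ?_
          rw [hy]
          exact mul_le_of_le_one_left (by positivity) (hit_le_one _ _)
        have h2 : 2 * (s / (4 * X)) ^ 2 * (X / s) = s / (8 * X) := by
          field_simp
          norm_num
        have h3 := mul_le_mul_of_nonneg_left h1 (by positivity : 0 ≤ 2 * (s / (4 * X)) ^ 2)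
        have h4 : s / (4 * X) = s / (8 * X) + s / (8 * X) := by
          field_simp
          norm_num
        rw [ht]
        linarith)
    have hA : ∑ r, ∑ i, hit (ρ i) r * (x i / √s) ^ 2 = X := by
      rw [Finset.sum_comm]
      simp only [← Finset.sum_mul, sum_hit, hy]
      refine Finset.sum_congr rfl fun i _ => ?_
      field_simp
    simp only [← Finset.mul_sum, Finset.sum_sub_distrib, hA] at h
    refine h.trans (mul_le_mul_of_nonneg_left ?_ (by positivity))
    -- Since T² (x i)² (x j)² / s² = w i j / 16, the exponent is a convex combination of overlaps,
    -- ready for Jensen.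
    have hexp : (s / (4 * X)) ^ 2 * (∑ r, (∑ i, hit (ρ i) r * (x i / √s) ^ 2) ^ 2 -
        ∑ r, ∑ i, (hit (ρ i) r * (x i / √s) ^ 2) ^ 2) =
        ∑ q : Fin N × Fin N, w q.1 q.2 • Q ρ q.1 q.2 := by
      have hoff : ∀ a : Fin N → ℝ, (∑ i, a i) ^ 2 - ∑ i, a i ^ 2 =
          ∑ i, ∑ j, if i = j then 0 else a i * a j := by
        intro a
        rw [sq, Finset.sum_mul_sum, ← Finset.sum_sub_distrib]
        refine Finset.sum_congr rfl fun i _ => ?_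
        rw [sub_eq_iff_eq_add, ← Finset.sum_erase_add _ _ (Finset.mem_univ i), sq,
          ← Finset.sum_erase_add (a := i) _ (fun j => if i = j then 0 else a i * a j)
            (Finset.mem_univ i), if_pos rfl, add_zero]
        congr 1
        refine Finset.sum_congr rfl fun j hj => ?_
        rw [if_neg (Finset.ne_of_mem_erase hj).symm]
      rw [← Finset.sum_sub_distrib]
      simp only [hoff]
      rw [Finset.sum_comm, Fintype.sum_prod_type, Finset.mul_sum]
      refine Finset.sum_congr rfl fun i _ => ?_
      rw [Finset.sum_comm, Finset.mul_sum]
      refine Finset.sum_congr rfl fun j _ => ?_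
      rcases eq_or_ne i j with hij | hij
      · simp [Q, hij]
      · simp only [Q, if_neg hij, hy, hw, smul_eq_mul, Finset.sum_div, Finset.mul_sum]
        refine Finset.sum_congr rfl fun r _ => ?_
        field_simp
        ring
    rw [hexp]
    exact convexOn_exp.map_sum_le (fun q _ => hw0 _ _) hw1 fun _ _ => Set.mem_univ _
  have hQ : ∀ i j, ∑ ρ, Real.exp (Q ρ i j) ≤
      Fintype.card (Fin N → Fin s ↪ Fin d) * Real.exp ((s : ℝ) ^ 2 / (4 * d)) := by
    intro i j
    rcases eq_or_ne i j with hij | hij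
    · simp only [Q, if_pos hij, Real.exp_zero, Finset.sum_const, nsmul_eq_mul, Finset.card_univ]
      gcongr
      exact Real.one_le_exp (by positivity)
    · simp only [Q, if_neg hij]
      exact sum_pi_pair_le hij (fun e e' => Real.exp ((∑ r, hit e r * hit e' r) / 16))
        fun e => sum_exp_overlap_le hs e
  rw [Fintype.sum_prod_type]
  calc _ ≤ ∑ ρ, (2 ^ s) ^ N * ∑ q : Fin N × Fin N, w q.1 q.2 * Real.exp (Q ρ q.1 q.2) :=
        Finset.sum_le_sum fun ρ _ => hsigns ρ
    _ = (2 ^ s) ^ N * ∑ q : Fin N × Fin N, w q.1 q.2 * ∑ ρ, Real.exp (Q ρ q.1 q.2) := by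
        rw [← Finset.mul_sum, Finset.sum_comm]
        simp only [Finset.mul_sum]
    _ ≤ (2 ^ s) ^ N * ∑ q : Fin N × Fin N, w q.1 q.2 *
          (Fintype.card (Fin N → Fin s ↪ Fin d) * Real.exp ((s : ℝ) ^ 2 / (4 * d))) := by
        refine mul_le_mul_of_nonneg_left (Finset.sum_le_sum fun q _ => ?_) (by positivity)
        exact mul_le_mul_of_nonneg_left (hQ _ _) (hw0 _ _)
    _ = _ := by
        rw [← Finset.sum_mul, hw1, Fintype.card_prod]
        simp
        ring

/-- A compression is given by the positions and the signs of its `2 d` columns. -/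
def compressionEquiv (d s : ℕ) :
    (Fin (d + d) → Fin s ↪ Fin d) × (Fin (d + d) → Fin s → Bool) ≃ Compression d s where
  toFun p := ⟨fun c => ⟨p.1 (Fin.castAdd d c), p.2 (Fin.castAdd d c)⟩,
    fun c => ⟨p.1 (Fin.natAdd d c), p.2 (Fin.natAdd d c)⟩⟩
  invFun φ := (Fin.append (fun c => (φ.left c).row) fun c => (φ.right c).row,
    Fin.append (fun c => (φ.left c).sign) fun c => (φ.right c).sign)
  left_inv p := by
    ext1 <;> exact Fin.append_castAdd_natAdd
  right_inv φ := by
    ext1 <;> ext1 c <;> simp only [Fin.append_left, Fin.append_right]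

instance (d s : ℕ) : Fintype (Compression d s) := Fintype.ofEquiv _ (compressionEquiv d s)

/-- Lets the two matrices be treated as one with 2d independent columns acting on the concatenated
vector. -/
theorem eval_compressionEquiv {d s : ℕ}
    (p : (Fin (d + d) → Fin s ↪ Fin d) × (Fin (d + d) → Fin s → Bool)) (x y : Fin d → ℝ)
    (r : Fin d) : (compressionEquiv d s p).eval x y r =
      ∑ i, Fin.append x y i / √s * entry (p.1 i) (p.2 i) r := by
  have h : ∀ (e : Fin s ↪ Fin d) (σ : Fin s → Bool) (z : ℝ),
      (∑ t, if e t = r then (Column.mk e σ).coef t else 0) * z = z / √s * entry e σ r := by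
    intro e σ z
    rw [entry, Finset.sum_mul, Finset.mul_sum]
    refine Finset.sum_congr rfl fun t _ => ?_
    split_ifs
    · simp only [Column.coef, sgn]
      ring
    · simp
  rw [Fin.sum_univ_add]
  simp only [Compression.eval, compressionEquiv, Equiv.coe_fn_mk, Pi.add_apply, Matrix.mulVec,
    dotProduct, toMatrix, Matrix.of_apply, Fin.append_left, Fin.append_right]
  exact congrArg₂ _ (Finset.sum_congr rfl fun i _ => h _ _ _)
    (Finset.sum_congr rfl fun i _ => h _ _ _)

/-- The exponential Markov inequality for the uniform distribution. -/
theorem uniformOn_real_le_of_sum_exp_le {Ω : Type} [Fintype Ω] [MeasurableSpace Ω]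
    [DiscreteMeasurableSpace Ω] [Nonempty Ω] {f : Ω → ℝ} {M : ℝ}
    (h : ∑ ω, Real.exp (f ω) ≤ Fintype.card Ω * M) (a : ℝ) :
    (uniformOn (Set.univ : Set Ω)).real {ω | a ≤ f ω} ≤ M * Real.exp (-a) := by
  classical
  have hpos : (0 : ℝ) < Fintype.card Ω := by exact_mod_cast Fintype.card_pos
  rw [measureReal_def, uniformOn_univ, Measure.count_apply .of_discrete, ENNReal.toReal_div,
    ENNReal.toReal_natCast, div_le_iff₀ hpos, Real.exp_neg, ← div_eq_mul_inv, div_mul_eq_mul_div,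
    le_div_iff₀ (Real.exp_pos a), mul_comm M]
  refine le_trans ?_ h
  rw [Set.encard_eq_coe_toFinset_card]
  simp only [ENat.toENNReal_coe, ENNReal.toReal_natCast]
  rw [← nsmul_eq_mul]
  refine (Finset.card_nsmul_le_sum _ (fun ω => Real.exp (f ω)) _ fun ω hω => ?_).trans
    (Finset.sum_le_univ_sum_of_nonneg fun ω => (Real.exp_pos _).le)
  simpa using hω

theorem isProbabilityMeasure_sparseSignLaw {d s : ℕ} (hs : s ≤ d) :
    IsProbabilityMeasure (sparseSignLaw d s) := by
  have : Nonempty (Compression d s) :=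
    ⟨⟨fun _ => ⟨Fin.castLEEmb hs, fun _ => true⟩, fun _ => ⟨Fin.castLEEmb hs, fun _ => true⟩⟩⟩
  exact isProbabilityMeasure_uniformOn Set.finite_univ Set.univ_nonempty

/-- Markov's inequality at t = ± s/(8X) handles the two tails, whose threshold is t · εX = sε/8 in
absolute value. The zero vector is treated apart, as t needs X > 0. -/
theorem isCompressionLaw_sparseSignLaw {d s : ℕ} (hs0 : 0 < s) (hs : 2 * s ≤ d) {ε δ : ℝ}
    (hδ0 : 0 ≤ δ)
    (hδ : 2 * (Real.exp ((s : ℝ) ^ 2 / (4 * d)) * Real.exp (-(s * ε / 8))) ≤ δ) :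
    IsCompressionLaw (sparseSignLaw d s) ε δ where
  isProbabilityMeasure := isProbabilityMeasure_sparseSignLaw (by omega)
  preserves x y := by
    have := isProbabilityMeasure_sparseSignLaw (d := d) (s := s) (by omega)
    have : Nonempty (Compression d s) := nonempty_of_isProbabilityMeasure (sparseSignLaw d s)
    set X := ∑ i, Fin.append x y i ^ 2 with hX
    have hXn : norm2 x ^ 2 + norm2 y ^ 2 = X := by
      simp only [hX, norm2_sq, Fin.sum_univ_add, Fin.append_left, Fin.append_right]
    have hev : ∀ p, norm2 ((compressionEquiv d s p).eval x y) ^ 2 =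
        ∑ r, (∑ i, Fin.append x y i / √s * entry (p.1 i) (p.2 i) r) ^ 2 := fun p => by
      simp only [norm2_sq, eval_compressionEquiv]
    simp only [hXn]
    have hX0 : 0 ≤ X := Finset.sum_nonneg fun i _ => sq_nonneg _
    rcases hX0.eq_or_lt with h0 | h0
    · have hz : ∀ i, Fin.append x y i = 0 := fun i => by
        have := (Finset.sum_eq_zero_iff_of_nonneg fun i _ => sq_nonneg (Fin.append x y i)).1 h0.symm
          i (Finset.mem_univ i)
        exact pow_eq_zero_iff two_ne_zero |>.1 this
      have huniv : {φ : Compression d s | (1 - ε) * X ≤ norm2 (φ.eval x y) ^ 2 ∧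
          norm2 (φ.eval x y) ^ 2 ≤ (1 + ε) * X} = Set.univ := by
        refine Set.eq_univ_of_forall fun φ => ?_
        obtain ⟨p, rfl⟩ := (compressionEquiv d s).surjective φ
        rw [Set.mem_ofPred_eq, hev, ← h0]
        simp [hz]
      rw [huniv, probReal_univ]
      linarith
    have hsR : (0 : ℝ) < s := by exact_mod_cast hs0
    have hmom : ∀ t : ℝ, |t| = s / (8 * X) → ∑ φ : Compression d s,
        Real.exp (t * (norm2 (φ.eval x y) ^ 2 - X)) ≤
          Fintype.card (Compression d s) * Real.exp ((s : ℝ) ^ 2 / (4 * d)) := by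
      intro t ht
      rw [← (compressionEquiv d s).sum_comp, ← Fintype.card_congr (compressionEquiv d s)]
      simp only [hev]
      exact sum_exp_distortion_le hs0 hs (Fin.append x y) h0 ht
    have ht0 : 0 < s / (8 * X) := by positivity
    have hup := uniformOn_real_le_of_sum_exp_le (hmom (s / (8 * X)) (abs_of_pos ht0)) (s * ε / 8)
    have hlo := uniformOn_real_le_of_sum_exp_le
      (hmom (-(s / (8 * X))) (by rw [abs_neg, abs_of_pos ht0])) (s * ε / 8)
    have hscale : s * ε / 8 = s / (8 * X) * (ε * X) := by
      field_simp
    have hcompl : (sparseSignLaw d s).real {φ : Compression d s |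
        (1 - ε) * X ≤ norm2 (φ.eval x y) ^ 2 ∧ norm2 (φ.eval x y) ^ 2 ≤ (1 + ε) * X}ᶜ ≤ δ := by
      refine le_trans ((measureReal_mono ?_).trans (measureReal_union_le _ _))
        ((add_le_add hup hlo).trans (by linarith))
      intro φ hφ
      rw [Set.mem_compl_iff, Set.mem_ofPred_eq, not_and_or, not_le, not_le] at hφ
      rw [hscale]
      rcases hφ with h | h
      · right
        rw [Set.mem_ofPred_eq, neg_mul, ← mul_neg]
        exact mul_le_mul_of_nonneg_left (by linarith) ht0.le
      · left
        exact mul_le_mul_of_nonneg_left (by linarith) ht0.le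
    rw [probReal_compl_eq_one_sub .of_discrete] at hcompl
    linarith

/-- In dimension `d ≥ 128 (γ + 2) log n / ε ^ 2`, about `ε d / 8` entries in each column suffice. -/
theorem exists_isCompressionLaw_sparseSignLaw {γ : ℝ} (hγ : 0 < γ) {n d : ℕ} {ε : ℝ} (hn : 2 ≤ n)
    (hε : 0 < ε) (hε1 : ε ≤ 1) (hd : 128 * (γ + 2) * (Real.log n / ε ^ 2) ≤ d) :
    ∃ s : ℕ, 1 ≤ s ∧ s ≤ d ∧ (s : ℝ) ≤ 1 * (ε * d) ∧
      IsCompressionLaw (sparseSignLaw d s) ε ((n : ℝ) ^ (-(γ + 1))) := by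
  have hn' : (2 : ℝ) ≤ n := by exact_mod_cast hn
  have hn0 : (0 : ℝ) < n := by linarith
  have hlog : Real.log 2 ≤ Real.log n := Real.log_le_log two_pos hn'
  have hlog2 := Real.log_two_gt_d9
  have hd' : 128 * (γ + 2) * Real.log n ≤ ε ^ 2 * d := by
    rw [← mul_div_assoc, div_le_iff₀ (by positivity)] at hd
    linarith
  -- Ensures that rounding up at most doubles εd/8.
  have hεd : 8 ≤ ε * d := by
    have : ε ^ 2 * d ≤ ε * d := by
      gcongr
      nlinarith
    nlinarith
  set s := ⌈ε * d / 8⌉₊ with hs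
  have hs1 : ε * d / 8 ≤ s := Nat.le_ceil _
  have hs2 : (s : ℝ) ≤ ε * d / 4 := by
    have := Nat.ceil_lt_add_one (a := ε * d / 8) (by positivity)
    linarith
  have hsd : ε * d ≤ d := mul_le_of_le_one_left (Nat.cast_nonneg _) hε1
  have hs0 : 0 < s := Nat.ceil_pos.2 (by positivity)
  have h2s : 2 * s ≤ d := by
    have : (2 * s : ℝ) ≤ d := by linarith
    exact_mod_cast this
  refine ⟨s, hs0, by omega, by linarith, isCompressionLaw_sparseSignLaw hs0 h2s (by positivity) ?_⟩
  have hd0 : (0 : ℝ) < d := by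
    have : 0 < d := by omega
    exact_mod_cast this
  -- From s ≤ εd/4 the overlap term is at most sε/16, half of the gain sε/8; the remaining sε/16 ≥
  -- ε²d/128 explains the constant 128. The spare log n, from γ + 2 instead of γ + 1, absorbs the
  -- factor 2 ≤ n.
  have he : (s : ℝ) ^ 2 / (4 * d) + -(s * ε / 8) ≤ -((γ + 2) * Real.log n) := by
    have h1 : (s : ℝ) ^ 2 / (4 * d) ≤ s * ε / 16 := by
      rw [div_le_iff₀ (by positivity)]
      nlinarith
    nlinarith
  rw [← Real.exp_add]
  calc 2 * Real.exp ((s : ℝ) ^ 2 / (4 * d) + -(s * ε / 8))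
      ≤ n * Real.exp (-((γ + 2) * Real.log n)) := by gcongr
    _ = (n : ℝ) ^ (-(γ + 1)) := by
        rw [Real.rpow_def_of_pos hn0]
        nth_rw 1 [← Real.exp_log hn0]
        rw [← Real.exp_add]
        congr 1
        ring

end Sketch

end

/-! ### Choice of the constants -/

theorem mainTheorem4 :
    ∃ C : ℝ, 0 < C ∧ ∀ γ : ℝ, 0 < γ →
    ∃ C₀ : ℝ, 0 < C₀ ∧ ∃ Cₛ : ℝ, 0 < Cₛ ∧ ∀ C₁ : ℝ, C₀ ≤ C₁ →
    ∃ K : ℝ, 0 < K ∧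
    ∀ (n d : ℕ) (ε : ℝ), 2 ≤ n → 0 < ε → ε ≤ 1 →
      C₀ * (Real.log n / ε ^ 2) ≤ d → (d : ℝ) ≤ C₁ * (Real.log n / ε ^ 2) →
      -- the maps that the procedure asks for exist: sparse sign matrices are such maps
      (∃ s : ℕ, 1 ≤ s ∧ s ≤ d ∧ (s : ℝ) ≤ Cₛ * (ε * d) ∧
        Sketch.IsCompressionLaw (Sketch.sparseSignLaw d s) ε ((n : ℝ) ^ (-(γ + 1)))) ∧
      -- with any such maps the procedure has the claimed properties
      (∀ (s : ℕ) (F : MeasureTheory.Measure (Sketch.Compression d s)),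
        (s : ℝ) ≤ Cₛ * (ε * d) →
        Sketch.IsCompressionLaw F ε ((n : ℝ) ^ (-(γ + 1))) →
        ∀ k : ℕ, 2 ^ k ≤ n → k * ε ≤ 1 →
          -- the stretch, for every fixed input, over `k` independent maps
          (∀ x : Fin (2 ^ k * d) → ℝ,
            1 - (n : ℝ) ^ (-γ) ≤
              (MeasureTheory.Measure.pi fun _ : Fin k => F).real
                {φ : Fin k → Sketch.Compression d s |
                  (1 - C * (k * ε)) * Sketch.norm2 x ≤
                      Sketch.norm2 (Sketch.singleSketch φ x).val ∧
                    Sketch.norm2 (Sketch.singleSketch φ x).val ≤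
                      (1 + C * (k * ε)) * Sketch.norm2 x}) ∧
          -- the running time, for every outcome of the random draw
          (∀ (φ : Fin k → Sketch.Compression d s) (x : Fin (2 ^ k * d) → ℝ),
            ((Sketch.singleSketch φ x).steps : ℝ) ≤
              K * (((2 ^ k * d : ℕ) : ℝ) * Real.log n / ε)) ∧
          -- linearity, for every outcome of the random draw
          (∀ φ : Fin k → Sketch.Compression d s,
            IsLinearMap ℝ fun x : Fin (2 ^ k * d) → ℝ => (Sketch.singleSketch φ x).val)) := by
  refine ⟨1, one_pos, fun γ hγ => ⟨128 * (γ + 2), by positivity, 1, one_pos, fun C₁ hC₁ => ?_⟩⟩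
  have hC₁0 : 0 < C₁ := lt_of_lt_of_le (by positivity) hC₁
  -- With L = (log n)/ε, s ≤ C₁L and L ≥ 1/2 give 20s + 13 ≤ (20C₁ + 26)L.
  refine ⟨20 * C₁ + 26, by positivity, fun n d ε hn hε hε1 hd hd1 =>
    ⟨Sketch.exists_isCompressionLaw_sparseSignLaw hγ hn hε hε1 hd, fun s F hs hF k hkn hk =>
      ⟨fun x => ?_, fun φ x => ?_, Sketch.isLinearMap_singleSketch⟩⟩⟩
  · have hn0 : (0 : ℝ) < n := by
      have : 0 < n := by omega
      exact_mod_cast this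
    have hkn' : (2 : ℝ) ^ k ≤ n := by exact_mod_cast hkn
    simp only [one_mul]
    refine le_trans ?_ (hF.pi_singleSketch_ge hε.le hε1 (by positivity) hk x)
    have h1 : (n : ℝ) * (n : ℝ) ^ (-(γ + 1)) = (n : ℝ) ^ (-γ) := by
      rw [← Real.rpow_one_add' hn0.le (by linarith)]
      congr 1
      ring
    have h2 : (2 : ℝ) ^ k * (n : ℝ) ^ (-(γ + 1)) ≤ n * (n : ℝ) ^ (-(γ + 1)) := by gcongr
    linarith
  · have hlog : Real.log 2 ≤ Real.log n :=
      Real.log_le_log two_pos (by exact_mod_cast hn)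
    have hlog2 := Real.log_two_gt_d9
    have hd0 : 1 ≤ d := by
      have hlog0 : 0 < Real.log n := by linarith
      have : (0 : ℝ) < d := lt_of_lt_of_le (by positivity) hd
      exact_mod_cast this
    have hsteps : ((Sketch.singleSketch φ x).steps : ℝ) ≤
        ((2 ^ k * d : ℕ) : ℝ) * (20 * s + 13) := by
      exact_mod_cast Sketch.steps_singleSketch φ x hd0
    refine hsteps.trans ?_
    rw [mul_div_assoc, mul_left_comm]
    gcongr
    have hs' : (s : ℝ) ≤ C₁ * (Real.log n / ε) := by
      calc (s : ℝ) ≤ 1 * (ε * d) := hs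
        _ ≤ 1 * (ε * (C₁ * (Real.log n / ε ^ 2))) := by gcongr
        _ = C₁ * (Real.log n / ε) := by field_simp
    have hL : 1 / 2 ≤ Real.log n / ε := by
      rw [le_div_iff₀ hε]
      linarith
    linarith
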